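/- Let $G=(V,E)$ be a finite, simple, connected, undirected graph, and write $N[x]$ for the closed neighbourhood of a vertex $x$. **The game.** Concurrent SCPR (Selfish Cops and Passive Robber) is played with three tokens on $G$: the cops $C_1,C_2$ and the robber $R$. A state is a triple $(x^1,x^2,x^3)\in V^3$ of locations of $C_1,C_2,R$, or a terminal state $\tau$; let $\mathbf S=V^3\cup\{\tau\}$. In a state $s=(x^1,x^2,x^3)$ the three tokens simultaneously choose moves $a^i\in N[x^i]$; in $\tau$ there is only a null move. A state with $x^1=x^3$ is a $C_1$-capture state, one with $x^2=x^3\ne x^1$ is a $C_2$-capture state. Every capture state moves to $\tau$, and $\tau$ moves to itself. From any other state the next state is $(a^1,a^2,a^3)$, except that if a cop $C_i$ and the robber traverse an edge in opposite directions ($a^i=x^3$, $a^3=x^i$), the robber is swept to the cop's destination, so that his new location is $a^i$. A strategy $\sigma_i$ assigns to each finite history $s_0s_1\dots s_t$ of states a probability distribution on the legal moves of token $i$ in $s_t$. It is stationary Markovian if this distribution depends on $s_t$ only. The robber's strategy $\sigma_3$ is fixed and known to the cops. Given the history, the three moves are chosen independently, so $\sigma_1,\sigma_2,\sigma_3$ and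 a starting state $s_0$ induce a probability measure on infinite histories. Let $q(s)=1$ if $s$ is a $C_1$-capture state and $q(s)=0$ otherwise, and let $J(\sigma_1,\sigma_2\mid s_0)=\mathbb E\big[\sum_{t\ge 0}q(s_t)\big]$. $C_1$ maximizes $J$ and $C_2$ minimizes it. The game started at $s_0$ has the value $v(s_0)$ if $$\sup_{\sigma_1}\inf_{\sigma_2}J(\sigma_1,\sigma_2\mid s_0)=v(s_0)=\inf_{\sigma_2}\sup_{\sigma_1}J(\sigma_1,\sigma_2\mid s_0).$$ For $\varepsilon\ge 0$, $\sigma_1$ is $\varepsilon$-optimal for $C_1$ if $\inf_{\sigma_2}J(\sigma_1,\sigma_2\mid s_0)\ge v(s_0)-\varepsilon$ for all $s_0$, and $\sigma_2$ is $\varepsilon$-optimal for $C_2$ if $\sup_{\sigma_1}J(\sigma_1,\sigma_2\mid s_0)\le v(s_0)+\varepsilon$ for all $s_0$; optimal means $0$-optimal. **Theorem.** Let $\sigma_3$ be any strategy of the robber. From every starting state $s$ the game has a (finite) value $v(s)$. If $\sigma_3$ is stationary Markovian, let $\Pr(s'\mid s,a_1,a_2)$ be the probability, determined by $\sigma_3$,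 that the next state is $s'$ when the cops move $a_1,a_2$ in the state $s$. Then: 1. the value vector $(v(s))_{s\in\mathbf S}$ is the smallest (componentwise) among the nonnegative solutions $w\in[0,\infty)^{\mathbf S}$ of $$w(\tau)=0,\qquad w(s)=\mathbf{Val}\Big[q(s)+\sum_{s'\in\mathbf S}\Pr(s'\mid s,a_1,a_2)\,w(s')\Big]\quad\text{for all } s\in V^3,$$ where $\mathbf{Val}[\Gamma(a_1,a_2)]$ is the value in mixed strategies of the one-turn zero-sum game with payoff $\Gamma(a_1,a_2)$ to $C_1$, for $s=(x^1,x^2,x^3)$, $a_1\in N[x^1]$, $a_2\in N[x^2]$; 2. $C_2$ has a stationary Markovian optimal strategy; 3. for every $\varepsilon>0$, $C_1$ has a stationary Markovian $\varepsilon$-optimal strategy. -/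

import Mathlib

open MeasureTheory ProbabilityTheory
open scoped ENNReal NNReal

namespace SCPR

/-- The three tokens: the two cops and the robber. -/
inductive Token
  | cop1 | cop2 | robber
  deriving DecidableEq

instance : Fintype Token := ⟨{.cop1, .cop2, .robber}, fun i => by cases i <;> decide⟩

/-- States of the concurrent game on a vertex set `V`: the locations of the three tokens, or the
terminal state `τ`. -/
inductive State (V : Type*)
  | active (x : Token → V)
  | terminal

/-- A state is a triple of locations or `τ`. -/
def State.equivOption (V : Type*) : State V ≃ Option (Token → V) where
  toFun
    | .active x => some x
    | .terminal => none
  invFun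
    | some x => .active x
    | none => .terminal
  left_inv s := by cases s <;> rfl
  right_inv s := by cases s <;> rfl

instance (V : Type*) [Fintype V] : Fintype (State V) :=
  Fintype.ofEquiv _ (State.equivOption V).symm

instance (V : Type*) : MeasurableSpace (State V) := ⊤

instance (V : Type*) : DiscreteMeasurableSpace (State V) := ⟨fun _ => trivial⟩

variable {V : Type*}

open Classical in
/-- Closed neighbourhood of a vertex. -/
noncomputable def closedNbhd [Fintype V] (G : SimpleGraph V) (x : V) : Finset V :=
  Finset.univ.filter fun y => y = x ∨ G.Adj x y

/-- Moves available to token `i`: a vertex of the closed neighbourhood of its location, or the null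
move `none` in the terminal state. -/
noncomputable def legalMoves [Fintype V] (G : SimpleGraph V) (i : Token) :
    State V → Finset (Option V)
  | .active x => (closedNbhd G (x i)).map Function.Embedding.some
  | .terminal => {none}

open Classical in
/-- Location of the robber after the simultaneous moves `a₁, a₂, a₃` from a state in which neither
cop is at the robber's vertex. If a cop and the robber traverse an edge in opposite directions, the
robber is swept to the destination of that cop; otherwise he arrives at `a₃`. -/
noncomputable def robberArrival (x : Token → V) (a₁ a₂ a₃ : V) : V :=
  if a₁ = x .robber ∧ a₃ = x .cop1 then a₁
  else if a₂ = x .robber ∧ a₃ = x .cop2 then a₂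
  else a₃

open Classical in
/-- The next state when the tokens make the moves `a₁, a₂, a₃`. Capture states and the terminal
state lead to the terminal state. (In an active state the null move is illegal and therefore has
probability zero; the value chosen for it is irrelevant.) -/
noncomputable def nextState : State V → Option V → Option V → Option V → State V
  | .active x, some a₁, some a₂, some a₃ =>
      if x .cop1 = x .robber ∨ x .cop2 = x .robber then .terminal
      else .active fun
        | .cop1 => a₁
        | .cop2 => a₂
        | .robber => robberArrival x a₁ a₂ a₃
  | _, _, _, _ => .terminal

open Classical in
/-- Immediate payoff to the first cop: `1` in the states in which he is at the robber's vertex,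
and `0` in all others. -/
noncomputable def immediatePayoff : State V → ℝ≥0
  | .active x => if x .cop1 = x .robber then 1 else 0
  | .terminal => 0

/-- The finite histories `s₀ s₁ … sₙ`. -/
abbrev History (V : Type*) (n : ℕ) := (Finset.Iic n) → State V

/-- The current state `sₙ` of a history `s₀ s₁ … sₙ`. -/
def History.last {n : ℕ} (h : History V n) : State V := h ⟨n, Finset.mem_Iic.2 le_rfl⟩

/-- A strategy of token `i`: for each finite history a probability distribution on the next move,
which gives probability zero to illegal moves. -/
structure Strategy [Fintype V] (G : SimpleGraph V) (i : Token) where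
  prob : (n : ℕ) → History V n → PMF (Option V)
  legal : ∀ (n : ℕ) (h : History V n) (a : Option V),
    a ∉ legalMoves G i h.last → prob n h a = 0

section

variable [Fintype V] {G : SimpleGraph V}

/-- Stationary Markovian: the distribution of the next move depends on the current state only. -/
def Strategy.IsStationaryMarkovian {i : Token} (σ : Strategy G i) : Prop :=
  ∃ f : State V → PMF (Option V), ∀ (n : ℕ) (h : History V n), σ.prob n h = f h.last

/-- Distribution of the next state after the history `h` when the cops make the moves `a₁, a₂` and
the robber moves according to `σ₃`. -/
noncomputable def transition (σ₃ : Strategy G .robber) {n : ℕ} (h : History V n)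
    (a₁ a₂ : Option V) : PMF (State V) :=
  (σ₃.prob n h).map (nextState h.last a₁ a₂)

/-- Distribution of the next state after the history `h` when the tokens choose their moves
independently according to their strategies. -/
noncomputable def step (σ₁ : Strategy G .cop1) (σ₂ : Strategy G .cop2) (σ₃ : Strategy G .robber)
    {n : ℕ} (h : History V n) : PMF (State V) :=
  (σ₁.prob n h).bind fun a₁ => (σ₂.prob n h).bind fun a₂ => transition σ₃ h a₁ a₂

/-- `step` as a Markov kernel. -/
noncomputable def stepKernel (σ₁ : Strategy G .cop1) (σ₂ : Strategy G .cop2)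
    (σ₃ : Strategy G .robber) (n : ℕ) : Kernel (History V n) (State V) :=
  Kernel.ofFunOfCountable fun h => (step σ₁ σ₂ σ₃ h).toMeasure

instance (σ₁ : Strategy G .cop1) (σ₂ : Strategy G .cop2) (σ₃ : Strategy G .robber) (n : ℕ) :
    IsMarkovKernel (stepKernel σ₁ σ₂ σ₃ n) :=
  ⟨fun h => PMF.toMeasure.isProbabilityMeasure (step σ₁ σ₂ σ₃ h)⟩

/-- The probability measure on infinite histories induced by the three strategies and the starting
state `s₀`. -/
noncomputable def playMeasure (σ₁ : Strategy G .cop1) (σ₂ : Strategy G .cop2)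
    (σ₃ : Strategy G .robber) (s₀ : State V) : Measure (ℕ → State V) :=
  Kernel.traj (X := fun _ => State V) (stepKernel σ₁ σ₂ σ₃) 0 fun _ => s₀

/-- Expected total payoff `J(σ₁, σ₂ | s₀)` to the first cop. -/
noncomputable def expectedPayoff (σ₁ : Strategy G .cop1) (σ₂ : Strategy G .cop2)
    (σ₃ : Strategy G .robber) (s₀ : State V) : ℝ≥0∞ :=
  ∫⁻ ω, ∑' t : ℕ, (immediatePayoff (ω t) : ℝ≥0∞) ∂playMeasure σ₁ σ₂ σ₃ s₀

/-- The zero-sum game started at `s₀` has the value `c`: `sup inf J = c = inf sup J`. -/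
def IsValue (σ₃ : Strategy G .robber) (s₀ : State V) (c : ℝ≥0∞) : Prop :=
  (⨆ σ₁ : Strategy G .cop1, ⨅ σ₂ : Strategy G .cop2, expectedPayoff σ₁ σ₂ σ₃ s₀) = c ∧
  (⨅ σ₂ : Strategy G .cop2, ⨆ σ₁ : Strategy G .cop1, expectedPayoff σ₁ σ₂ σ₃ s₀) = c

/-- With `v` the vector of values, `σ₁` guarantees the first cop the value up to `ε` from every
starting state. -/
def IsEpsOptimal₁ (σ₃ : Strategy G .robber) (v : State V → ℝ≥0) (ε : ℝ≥0)
    (σ₁ : Strategy G .cop1) : Prop :=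
  ∀ s₀ : State V,
    (v s₀ : ℝ≥0∞) ≤ (⨅ σ₂ : Strategy G .cop2, expectedPayoff σ₁ σ₂ σ₃ s₀) + ε

/-- With `v` the vector of values, `σ₂` guarantees the second cop the value up to `ε` from every
starting state. -/
def IsEpsOptimal₂ (σ₃ : Strategy G .robber) (v : State V → ℝ≥0) (ε : ℝ≥0)
    (σ₂ : Strategy G .cop2) : Prop :=
  ∀ s₀ : State V,
    (⨆ σ₁ : Strategy G .cop1, expectedPayoff σ₁ σ₂ σ₃ s₀) ≤ (v s₀ : ℝ≥0∞) + ε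

/-- Value of the one-turn zero-sum game with payoff matrix `Γ` (in mixed strategies). -/
noncomputable def matrixValue {A B : Type*} [Fintype A] [Fintype B] (Γ : A → B → ℝ) : ℝ :=
  ⨆ p : stdSimplex ℝ A, ⨅ r : stdSimplex ℝ B, ∑ a, ∑ b, p.1 a * r.1 b * Γ a b

/-- For a stationary Markovian `σ₃`: the probability `Pr(s' | s, a₁, a₂)`. The move distribution of
such a `σ₃` in the state `s` is read off at the history that consists of `s` alone. -/
noncomputable def transProb (σ₃ : Strategy G .robber) (s : State V) (a₁ a₂ : Option V)
    (s' : State V) : ℝ :=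
  (transition σ₃ (n := 0) (fun _ => s) a₁ a₂ s').toReal

/-- The optimality equations, for a stationary Markovian `σ₃` and a nonnegative vector `w`:
`w(τ) = 0`, and `w(s) = Val[q(s) + ∑ Pr(s' | s, a₁, a₂) w(s')]` for all other `s`, where `a₁`, `a₂`
range over the moves available to the two cops. -/
def SolvesOptimalityEquations (σ₃ : Strategy G .robber) (w : State V → ℝ≥0) : Prop :=
  w .terminal = 0 ∧
  ∀ x : Token → V,
    (w (.active x) : ℝ) =
      matrixValue fun (a₁ : ↥(legalMoves G .cop1 (.active x)))
          (a₂ : ↥(legalMoves G .cop2 (.active x))) =>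
        (immediatePayoff (.active x) : ℝ) +
          ∑ s' : State V, transProb σ₃ (.active x) a₁ a₂ s' * (w s' : ℝ)

end

end SCPR

/-! A capture by C₁ pays 1 and is followed by `τ`, so truncated values lie in [0, 1]. Backward
induction, with the minimax theorem at every turn, gives the value of `k` stages with discount
factor `β`; it increases with `k` to `limitValue`. Since the robber may use the whole past, values
belong to histories rather than states. There are finitely many states, so the limit satisfies the
one-turn optimality equation (`limitValue_eq_turnValue`).

For C₂ take `β = 1`. Optimal play in each one-turn game makes accumulated payoff plus continuation
value a supermartingale, which bounds the expected payoff by the value (`expectedPayoff_le`). The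
same recipe can fail for C₁, who may postpone a capture forever without lowering the continuation
value. With `β < 1` the unpaid remainder after `n` turns is at most `β ^ n`, so greedy play does
secure the discounted value (`le_expectedPayoff`), and this value tends to the undiscounted one as
`β → 1` (`exists_limitValue_le_add`). Hence an optimal strategy for C₂ but only `ε`-optimal ones for
C₁.

Against a stationary Markovian robber all these values, and so the greedy strategies, depend on the
current state only. Value iteration from 0 is monotone and stays below every nonnegative solution,
so its limit is the least one. -/

namespace SCPR

/-! ### Matrix games and the minimax theorem -/

section MatrixGame

variable {A B : Type*} [Fintype A] [Fintype B]

/-- Von Neumann's minimax theorem: both players have optimal mixed strategies. -/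
theorem exists_optimal_matrixValue [Nonempty A] [Nonempty B] (Γ : A → B → ℝ) :
    ∃ p ∈ stdSimplex ℝ A, ∃ r ∈ stdSimplex ℝ B,
      (∀ b, matrixValue Γ ≤ ∑ a, p a * Γ a b) ∧ ∀ a, ∑ b, r b * Γ a b ≤ matrixValue Γ := by
  classical
  set f : (B → ℝ) → (A → ℝ) → ℝ := fun r p => ∑ a, ∑ b, p a * r b * Γ a b with hf
  have hcr : ∀ p, Continuous fun r => f r p := fun p => by simp only [hf]; fun_prop
  have hcp : ∀ r, Continuous fun p => f r p := fun r => by simp only [hf]; fun_prop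
  have hneA : (stdSimplex ℝ A).Nonempty := ⟨_, single_mem_stdSimplex ℝ (Classical.arbitrary A)⟩
  have hneB : (stdSimplex ℝ B).Nonempty := ⟨_, single_mem_stdSimplex ℝ (Classical.arbitrary B)⟩
  have hlin₁ : ∀ p, IsLinearMap ℝ fun r => f r p := fun p =>
    ⟨fun x y => by simp [hf, mul_add, add_mul, Finset.sum_add_distrib],
      fun c x => by
        simp only [hf, Pi.smul_apply, smul_eq_mul, Finset.mul_sum]
        exact Finset.sum_congr rfl fun _ _ => Finset.sum_congr rfl fun _ _ => by ring⟩
  have hlin₂ : ∀ r, IsLinearMap ℝ fun p => f r p := fun r =>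
    ⟨fun x y => by simp [hf, add_mul, Finset.sum_add_distrib],
      fun c x => by
        simp only [hf, Pi.smul_apply, smul_eq_mul, Finset.mul_sum]
        exact Finset.sum_congr rfl fun _ _ => Finset.sum_congr rfl fun _ _ => by ring⟩
  obtain ⟨r, hr, p, hp, hsad⟩ := Sion.exists_isSaddlePointOn (f := f)
    hneB (convex_stdSimplex ℝ B) (isCompact_stdSimplex ℝ B)
    (fun p _ => (hcr p).lowerSemicontinuous.lowerSemicontinuousOn _)
    (fun p _ => ((hlin₁ p).mk' _ |>.convexOn (convex_stdSimplex ℝ B)).quasiconvexOn)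
    (convex_stdSimplex ℝ A) hneA (isCompact_stdSimplex ℝ A)
    (fun r _ => (hcp r).upperSemicontinuous.upperSemicontinuousOn _)
    (fun r _ => ((hlin₂ r).mk' _ |>.concaveOn (convex_stdSimplex ℝ A)).quasiconcaveOn)
  have hle : ∀ p' : stdSimplex ℝ A, (⨅ r' : stdSimplex ℝ B, f r' p') ≤ f r p := fun p' => by
    -- The infimum is taken in `ℝ`, so it is meaningful only once compactness of the simplex bounds
    -- it below.
    have hb : BddBelow (Set.range fun r' : stdSimplex ℝ B => f r' p') := by
      have : CompactSpace (stdSimplex ℝ B) :=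
        isCompact_iff_compactSpace.1 (isCompact_stdSimplex ℝ B)
      exact (isCompact_range ((hcr p').comp continuous_subtype_val)).bddBelow
    exact (ciInf_le hb ⟨r, hr⟩).trans (hsad r hr p' p'.2)
  have : Nonempty (stdSimplex ℝ A) := hneA.to_subtype
  have : Nonempty (stdSimplex ℝ B) := hneB.to_subtype
  have hval : matrixValue Γ = f r p := by
    refine le_antisymm (ciSup_le hle) ?_
    refine le_trans (le_ciInf fun r' : stdSimplex ℝ B => hsad r' r'.2 p hp)
      (le_ciSup (f := fun p' : stdSimplex ℝ A => ⨅ r' : stdSimplex ℝ B, f r' p') ?_ ⟨p, hp⟩)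
    exact ⟨f r p, by rintro _ ⟨p', rfl⟩; exact hle p'⟩
  refine ⟨p, hp, r, hr, fun b => ?_, fun a => ?_⟩
  · rw [hval]
    refine (hsad _ (single_mem_stdSimplex ℝ b) p hp).trans_eq ?_
    simp [hf, Pi.single_apply]
  · rw [hval]
    refine le_trans (le_of_eq ?_) (hsad r hr _ (single_mem_stdSimplex ℝ a))
    simp [hf, Pi.single_apply, Finset.sum_ite_eq']

theorem le_matrixValue [Nonempty A] [Nonempty B] {Γ : A → B → ℝ} {c : ℝ} {p : A → ℝ}
    (hp : p ∈ stdSimplex ℝ A) (h : ∀ b, c ≤ ∑ a, p a * Γ a b) : c ≤ matrixValue Γ := by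
  obtain ⟨-, -, r, hr, -, h'⟩ := exists_optimal_matrixValue Γ
  calc c = ∑ b, r b * c := by rw [← Finset.sum_mul, hr.2, one_mul]
    _ ≤ ∑ b, r b * ∑ a, p a * Γ a b :=
      Finset.sum_le_sum fun b _ => mul_le_mul_of_nonneg_left (h b) (hr.1 b)
    _ = ∑ a, p a * ∑ b, r b * Γ a b := by
      simp only [Finset.mul_sum]
      rw [Finset.sum_comm]
      exact Finset.sum_congr rfl fun _ _ => Finset.sum_congr rfl fun _ _ => by ring
    _ ≤ ∑ a, p a * matrixValue Γ :=
      Finset.sum_le_sum fun a _ => mul_le_mul_of_nonneg_left (h' a) (hp.1 a)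
    _ = matrixValue Γ := by rw [← Finset.sum_mul, hp.2, one_mul]

/-- A mixed move optimal for `Γ` guarantees `c * matrixValue Γ - δ` in `Γ'`. The two parameters
cover monotonicity (`c = 1`, `δ = 0`), nonexpansiveness (`c = 1`) and comparison of discount factors
(`δ = 0`). -/
theorem mul_matrixValue_le [Nonempty A] [Nonempty B] {Γ Γ' : A → B → ℝ} {c δ : ℝ} (hc : 0 ≤ c)
    (h : ∀ a b, c * Γ a b ≤ Γ' a b + δ) : c * matrixValue Γ ≤ matrixValue Γ' + δ := by
  obtain ⟨p, hp, -, -, h', -⟩ := exists_optimal_matrixValue Γ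
  rw [← sub_le_iff_le_add]
  refine le_matrixValue hp fun b => ?_
  rw [sub_le_iff_le_add]
  calc c * matrixValue Γ ≤ c * ∑ a, p a * Γ a b := mul_le_mul_of_nonneg_left (h' b) hc
    _ = ∑ a, p a * (c * Γ a b) := by
      rw [Finset.mul_sum]; exact Finset.sum_congr rfl fun _ _ => by ring
    _ ≤ ∑ a, p a * (Γ' a b + δ) :=
      Finset.sum_le_sum fun a _ => mul_le_mul_of_nonneg_left (h a b) (hp.1 a)
    _ = ∑ a, p a * Γ' a b + δ := by
      simp only [mul_add, Finset.sum_add_distrib, ← Finset.sum_mul, hp.2, one_mul]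

theorem matrixValue_nonneg [Nonempty A] [Nonempty B] {Γ : A → B → ℝ} (h : ∀ a b, 0 ≤ Γ a b) :
    0 ≤ matrixValue Γ := by
  obtain ⟨p, hp, -⟩ := exists_optimal_matrixValue Γ
  exact le_matrixValue hp fun b => Finset.sum_nonneg fun a _ => mul_nonneg (hp.1 a) (h a b)

theorem matrixValue_le [Nonempty A] [Nonempty B] {Γ : A → B → ℝ} {c : ℝ}
    (h : ∀ a b, Γ a b ≤ c) : matrixValue Γ ≤ c := by
  obtain ⟨p, hp, -, -, h', -⟩ := exists_optimal_matrixValue Γ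
  refine (h' (Classical.arbitrary B)).trans ?_
  calc ∑ a, p a * Γ a _ ≤ ∑ a, p a * c :=
      Finset.sum_le_sum fun a _ => mul_le_mul_of_nonneg_left (h a _) (hp.1 a)
    _ = c := by rw [← Finset.sum_mul, hp.2, one_mul]

end MatrixGame

/-! ### One-turn games with nonnegative payoffs and mixed moves as `PMF`s -/

section GameValue

variable {α : Type*}

/-- The value of the one-turn game with nonnegative payoff `Γ`, in which the two players are
restricted to the moves in `S` and in `T`. -/
noncomputable def gameValue (S T : Finset α) (Γ : α → α → ℝ≥0) : ℝ≥0 :=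
  (matrixValue fun (a : ↥S) (b : ↥T) => (Γ a b : ℝ)).toNNReal

variable {S T : Finset α}

theorem coe_gameValue (hS : S.Nonempty) (hT : T.Nonempty) (Γ : α → α → ℝ≥0) :
    (gameValue S T Γ : ℝ) = matrixValue fun (a : ↥S) (b : ↥T) => (Γ a b : ℝ) := by
  have := hS.to_subtype
  have := hT.to_subtype
  exact Real.coe_toNNReal _ (matrixValue_nonneg fun a b => (Γ a b).2)

theorem mul_gameValue_le (hS : S.Nonempty) (hT : T.Nonempty) {Γ Γ' : α → α → ℝ≥0} {c δ : ℝ≥0}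
    (h : ∀ a ∈ S, ∀ b ∈ T, c * Γ a b ≤ Γ' a b + δ) :
    c * gameValue S T Γ ≤ gameValue S T Γ' + δ := by
  have := hS.to_subtype
  have := hT.to_subtype
  rw [← NNReal.coe_le_coe]
  push_cast
  rw [coe_gameValue hS hT, coe_gameValue hS hT]
  exact mul_matrixValue_le c.2 fun a b => by exact_mod_cast h a a.2 b b.2

theorem gameValue_mono (hS : S.Nonempty) (hT : T.Nonempty) {Γ Γ' : α → α → ℝ≥0}
    (h : ∀ a ∈ S, ∀ b ∈ T, Γ a b ≤ Γ' a b) : gameValue S T Γ ≤ gameValue S T Γ' := by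
  simpa using mul_gameValue_le (c := 1) (δ := 0) hS hT (by simpa using h)

theorem gameValue_le (hS : S.Nonempty) (hT : T.Nonempty) {Γ : α → α → ℝ≥0} {c : ℝ≥0}
    (h : ∀ a ∈ S, ∀ b ∈ T, Γ a b ≤ c) : gameValue S T Γ ≤ c := by
  have := hS.to_subtype
  have := hT.to_subtype
  rw [← NNReal.coe_le_coe, coe_gameValue hS hT]
  exact matrixValue_le fun a b => by exact_mod_cast h a a.2 b b.2

open Classical in
theorem exists_pmf_of_mem_stdSimplex {p : ↥S → ℝ} (hp : p ∈ stdSimplex ℝ ↥S) :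
    ∃ μ : PMF α, (∀ a ∉ S, μ a = 0) ∧
      ∀ f : α → ℝ≥0, ∑' a, μ a * f a = ENNReal.ofReal (∑ a : ↥S, p a * f a) := by
  set g : α → ℝ≥0∞ := fun a => if h : a ∈ S then ENNReal.ofReal (p ⟨a, h⟩) else 0 with hg
  have hp₀ : ∀ a, 0 ≤ p a := hp.1
  have hg' : ∀ a : ↥S, g a = ENNReal.ofReal (p a) := fun a => by simp [hg]
  have h0 : ∀ a ∉ S, g a = 0 := fun a ha => by simp [hg, ha]
  refine ⟨PMF.ofFinset g S ?_ h0, h0, fun f => ?_⟩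
  · rw [← Finset.sum_coe_sort, Finset.sum_congr rfl fun a _ => hg' a,
      ← ENNReal.ofReal_sum_of_nonneg fun a _ => hp₀ a, hp.2, ENNReal.ofReal_one]
  · rw [tsum_eq_sum (s := S) fun a ha => by simp [h0 a ha],
      ← Finset.sum_coe_sort, ENNReal.ofReal_sum_of_nonneg fun a _ => mul_nonneg (hp₀ a) (f a).coe_nonneg]
    refine Finset.sum_congr rfl fun a _ => ?_
    rw [PMF.ofFinset_apply, hg', ENNReal.ofReal_mul (hp₀ a), ENNReal.ofReal_coe_nnreal]

theorem exists_maximin_pmf (hS : S.Nonempty) (hT : T.Nonempty) (Γ : α → α → ℝ≥0) :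
    ∃ μ : PMF α, (∀ a ∉ S, μ a = 0) ∧
      ∀ b ∈ T, (gameValue S T Γ : ℝ≥0∞) ≤ ∑' a, μ a * Γ a b := by
  have := hS.to_subtype
  have := hT.to_subtype
  obtain ⟨p, hp, -, -, h, -⟩ :=
    exists_optimal_matrixValue fun (a : ↥S) (b : ↥T) => (Γ a b : ℝ)
  obtain ⟨μ, hμ, hμ'⟩ := exists_pmf_of_mem_stdSimplex hp
  refine ⟨μ, hμ, fun b hb => ?_⟩
  rw [hμ' fun a => Γ a b]
  exact ENNReal.ofReal_le_ofReal (h ⟨b, hb⟩)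

theorem exists_minimax_pmf (hS : S.Nonempty) (hT : T.Nonempty) (Γ : α → α → ℝ≥0) :
    ∃ ν : PMF α, (∀ b ∉ T, ν b = 0) ∧
      ∀ a ∈ S, ∑' b, ν b * Γ a b ≤ (gameValue S T Γ : ℝ≥0∞) := by
  have := hS.to_subtype
  have := hT.to_subtype
  obtain ⟨-, -, r, hr, -, h⟩ :=
    exists_optimal_matrixValue fun (a : ↥S) (b : ↥T) => (Γ a b : ℝ)
  obtain ⟨ν, hν, hν'⟩ := exists_pmf_of_mem_stdSimplex hr
  refine ⟨ν, hν, fun a ha => ?_⟩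
  rw [hν' fun b => Γ a b]
  exact ENNReal.ofReal_le_ofReal (h ⟨a, ha⟩)

theorem tsum_pmf_mul_le (μ : PMF α) {f : α → ℝ≥0∞} {c : ℝ≥0∞} (hμ : ∀ a ∉ S, μ a = 0)
    (h : ∀ a ∈ S, f a ≤ c) : ∑' a, μ a * f a ≤ c := by
  calc ∑' a, μ a * f a ≤ ∑' a, μ a * c := ENNReal.tsum_le_tsum fun a => by
        by_cases ha : a ∈ S
        · exact mul_le_mul_right (h a ha) _
        · simp [hμ a ha]
    _ = c := by rw [ENNReal.tsum_mul_right, μ.tsum_coe, one_mul]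

theorem le_tsum_pmf_mul (μ : PMF α) {f : α → ℝ≥0∞} {c : ℝ≥0∞} (hμ : ∀ a ∉ S, μ a = 0)
    (h : ∀ a ∈ S, c ≤ f a) : c ≤ ∑' a, μ a * f a := by
  calc c = ∑' a, μ a * c := by rw [ENNReal.tsum_mul_right, μ.tsum_coe, one_mul]
    _ ≤ ∑' a, μ a * f a := ENNReal.tsum_le_tsum fun a => by
        by_cases ha : a ∈ S
        · exact mul_le_mul_right (h a ha) _
        · simp [hμ a ha]

end GameValue

/-! ### Values of the finite-stage and discounted games -/

variable {V : Type*}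

/-- The history that consists of the state `s` alone. -/
def History.start (s : State V) : History V 0 := fun _ => s

/-- The history `h` followed by the state `s`. -/
def History.snoc {n : ℕ} (h : History V n) (s : State V) : History V (n + 1) := fun i =>
  if hi : i.1 ≤ n then h ⟨i.1, Finset.mem_Iic.2 hi⟩ else s

@[simp]
theorem History.last_start (s : State V) : (History.start s).last = s := rfl

@[simp]
theorem History.last_snoc {n : ℕ} (h : History V n) (s : State V) : (h.snoc s).last = s := by
  simp [History.last, History.snoc]

theorem nextState_terminal (a₁ a₂ a₃ : Option V) :
    nextState (.terminal : State V) a₁ a₂ a₃ = .terminal := by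
  cases a₁ <;> cases a₂ <;> cases a₃ <;> rfl

theorem nextState_of_capture {x : Token → V} (hx : x .cop1 = x .robber) (a₁ a₂ a₃ : Option V) :
    nextState (.active x) a₁ a₂ a₃ = .terminal := by
  cases a₁ <;> cases a₂ <;> cases a₃ <;> simp [nextState, hx]

section

variable [Fintype V] {G : SimpleGraph V}

theorem legalMoves_nonempty (i : Token) (s : State V) : (legalMoves G i s).Nonempty := by
  cases s with
  | active x => exact ⟨some (x i), by simp [legalMoves, closedNbhd]⟩
  | terminal => exact ⟨none, by simp [legalMoves]⟩

/-- Payoffs of the one-turn game after the history `h`, when the continuation from the next state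
is worth `w` and is discounted by `β`. -/
noncomputable def turnPayoff (σ₃ : Strategy G .robber) (β : ℝ≥0) {n : ℕ} (h : History V n)
    (w : State V → ℝ≥0) (a₁ a₂ : Option V) : ℝ≥0 :=
  immediatePayoff h.last + β * ∑ s, (transition σ₃ h a₁ a₂ s).toNNReal * w s

/-- Value of the one-turn game with payoffs `turnPayoff`. -/
noncomputable def turnValue (σ₃ : Strategy G .robber) (β : ℝ≥0) {n : ℕ} (h : History V n)
    (w : State V → ℝ≥0) : ℝ≥0 :=
  gameValue (legalMoves G .cop1 h.last) (legalMoves G .cop2 h.last) (turnPayoff σ₃ β h w)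

/-- Value, after the history `h`, of the next `k` stages of the `β`-discounted game. -/
noncomputable def stageValue (σ₃ : Strategy G .robber) (β : ℝ≥0) :
    ℕ → ∀ {n : ℕ}, History V n → ℝ≥0
  | 0, _, _ => 0
  | k + 1, _, h => turnValue σ₃ β h fun s => stageValue σ₃ β k (h.snoc s)

/-- Value of the `β`-discounted game after the history `h`. -/
noncomputable def limitValue (σ₃ : Strategy G .robber) (β : ℝ≥0) {n : ℕ} (h : History V n) : ℝ≥0 :=
  ⨆ k, stageValue σ₃ β k h

variable (σ₃ : Strategy G .robber) {β : ℝ≥0} {n : ℕ} (h : History V n)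

theorem sum_toNNReal_pmf (μ : PMF (State V)) : ∑ s, (μ s).toNNReal = 1 := by
  rw [← ENNReal.coe_inj]
  push_cast
  rw [Finset.sum_congr rfl fun s _ => ENNReal.coe_toNNReal (μ.apply_ne_top s),
    ← tsum_fintype (L := .unconditional _), μ.tsum_coe]

theorem turnPayoff_mono {w w' : State V → ℝ≥0} (hw : ∀ s, w s ≤ w' s) (a₁ a₂ : Option V) :
    turnPayoff σ₃ β h w a₁ a₂ ≤ turnPayoff σ₃ β h w' a₁ a₂ := by
  unfold turnPayoff
  gcongr with s
  exact hw s

/-- Transition probabilities have total mass one, so a constant error in the continuation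
contributes `β * δ ≤ δ`. -/
theorem turnPayoff_le_add {w w' : State V → ℝ≥0} {δ : ℝ≥0} (hβ : β ≤ 1)
    (hw : ∀ s, w s ≤ w' s + δ) (a₁ a₂ : Option V) :
    turnPayoff σ₃ β h w a₁ a₂ ≤ turnPayoff σ₃ β h w' a₁ a₂ + δ := by
  unfold turnPayoff
  rw [add_assoc]
  gcongr
  calc β * ∑ s, (transition σ₃ h a₁ a₂ s).toNNReal * w s
      ≤ β * ∑ s, (transition σ₃ h a₁ a₂ s).toNNReal * (w' s + δ) := by
        gcongr with s
        exact hw s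
    _ = β * ∑ s, (transition σ₃ h a₁ a₂ s).toNNReal * w' s + β * δ := by
        simp only [mul_add, Finset.sum_add_distrib, ← Finset.sum_mul, sum_toNNReal_pmf, one_mul]
    _ ≤ β * ∑ s, (transition σ₃ h a₁ a₂ s).toNNReal * w' s + δ := by
        gcongr
        exact mul_le_of_le_one_left' hβ

theorem turnValue_mono {w w' : State V → ℝ≥0} (hw : ∀ s, w s ≤ w' s) :
    turnValue σ₃ β h w ≤ turnValue σ₃ β h w' :=
  gameValue_mono (legalMoves_nonempty _ _) (legalMoves_nonempty _ _)
    fun a _ b _ => turnPayoff_mono σ₃ h hw a b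

theorem turnValue_le_add {w w' : State V → ℝ≥0} {δ : ℝ≥0} (hβ : β ≤ 1)
    (hw : ∀ s, w s ≤ w' s + δ) : turnValue σ₃ β h w ≤ turnValue σ₃ β h w' + δ := by
  simpa [turnValue] using mul_gameValue_le (c := 1) (legalMoves_nonempty _ _) (legalMoves_nonempty _ _)
    fun a _ b _ => by simpa using turnPayoff_le_add σ₃ h hβ hw a b

theorem transition_of_nextState_eq_terminal {a₁ a₂ : Option V}
    (hs : ∀ a₃, nextState h.last a₁ a₂ a₃ = .terminal) :
    transition σ₃ h a₁ a₂ = PMF.pure .terminal := by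
  rw [transition, funext hs]
  exact PMF.map_const _ _

theorem turnPayoff_of_nextState_eq_terminal {a₁ a₂ : Option V} {w : State V → ℝ≥0}
    (hs : ∀ a₃, nextState h.last a₁ a₂ a₃ = .terminal) (hw : w .terminal = 0) :
    turnPayoff σ₃ β h w a₁ a₂ = immediatePayoff h.last := by
  classical
  rw [turnPayoff, transition_of_nextState_eq_terminal σ₃ h hs, Finset.sum_eq_zero, mul_zero,
    add_zero]
  intro s _
  by_cases hs' : s = .terminal
  · simp [hs', hw]
  · simp [PMF.pure_apply, hs']

/-- No payoff is counted twice: where the immediate payoff is nonzero, C₁ has captured, the next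
state is `τ`, and the continuation is worth 0. -/
theorem turnValue_le_one (hβ : β ≤ 1) {w : State V → ℝ≥0} (hw : ∀ s, w s ≤ 1)
    (hw₀ : w .terminal = 0) : turnValue σ₃ β h w ≤ 1 := by
  refine gameValue_le (legalMoves_nonempty _ _) (legalMoves_nonempty _ _) fun a₁ _ a₂ _ => ?_
  by_cases hq : immediatePayoff h.last = 0
  · have h0 : turnPayoff σ₃ β h (fun _ => 0) a₁ a₂ = 0 := by simp [turnPayoff, hq]
    simpa [h0] using turnPayoff_le_add σ₃ h hβ (w' := fun _ => 0) (δ := 1) (by simpa using hw) a₁ a₂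
  · generalize hs : h.last = s at hq
    cases s with
    | terminal => exact absurd rfl hq
    | active x =>
      have hx : x .cop1 = x .robber := by
        by_contra hx
        exact hq (by simp [immediatePayoff, hx])
      rw [turnPayoff_of_nextState_eq_terminal σ₃ h (hs ▸ nextState_of_capture hx a₁ a₂) hw₀, hs]
      simp [immediatePayoff, hx]

theorem turnValue_of_last_eq_terminal (hs : h.last = .terminal) {w : State V → ℝ≥0}
    (hw₀ : w .terminal = 0) : turnValue σ₃ β h w = 0 := by
  refine le_antisymm (gameValue_le (legalMoves_nonempty _ _) (legalMoves_nonempty _ _)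
    fun a₁ _ a₂ _ => ?_) zero_le
  rw [turnPayoff_of_nextState_eq_terminal σ₃ h (hs ▸ nextState_terminal a₁ a₂) hw₀, hs]
  exact le_rfl

theorem stageValue_of_last_eq_terminal (k : ℕ) (hs : h.last = .terminal) :
    stageValue σ₃ β k h = 0 := by
  induction k generalizing n with
  | zero => rfl
  | succ k ih => exact turnValue_of_last_eq_terminal σ₃ h hs (ih _ (by simp))

theorem stageValue_le_one (hβ : β ≤ 1) (k : ℕ) : stageValue σ₃ β k h ≤ 1 := by
  induction k generalizing n with
  | zero => exact zero_le
  | succ k ih =>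
    exact turnValue_le_one σ₃ h hβ (fun s => ih _)
      (stageValue_of_last_eq_terminal σ₃ _ k (by simp))

theorem stageValue_le_succ (k : ℕ) : stageValue σ₃ β k h ≤ stageValue σ₃ β (k + 1) h := by
  induction k generalizing n with
  | zero => exact zero_le
  | succ k ih => exact turnValue_mono σ₃ h fun s => ih _

theorem monotone_stageValue : Monotone fun k => stageValue σ₃ β k h :=
  monotone_nat_of_le_succ (stageValue_le_succ σ₃ h)

theorem bddAbove_stageValue (hβ : β ≤ 1) : BddAbove (Set.range fun k => stageValue σ₃ β k h) :=
  ⟨1, by rintro _ ⟨k, rfl⟩; exact stageValue_le_one σ₃ h hβ k⟩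

theorem stageValue_le_limitValue (hβ : β ≤ 1) (k : ℕ) :
    stageValue σ₃ β k h ≤ limitValue σ₃ β h :=
  le_ciSup (bddAbove_stageValue σ₃ h hβ) k

theorem limitValue_le_one (hβ : β ≤ 1) : limitValue σ₃ β h ≤ 1 :=
  ciSup_le fun k => stageValue_le_one σ₃ h hβ k

theorem limitValue_of_last_eq_terminal (hs : h.last = .terminal) : limitValue σ₃ β h = 0 := by
  simp [limitValue, stageValue_of_last_eq_terminal σ₃ h _ hs]

theorem tendsto_stageValue (hβ : β ≤ 1) :
    Filter.Tendsto (fun k => stageValue σ₃ β k h) .atTop (nhds (limitValue σ₃ β h)) :=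
  tendsto_atTop_ciSup (monotone_stageValue σ₃ h) (bddAbove_stageValue σ₃ h hβ)

/-- One inequality is monotonicity. For the other, the one-turn value is nonexpansive in the
continuation, so uniform convergence over the next states suffices. -/
theorem limitValue_eq_turnValue (hβ : β ≤ 1) :
    limitValue σ₃ β h = turnValue σ₃ β h fun s => limitValue σ₃ β (h.snoc s) := by
  refine le_antisymm (ciSup_le fun k => ?_) (le_of_forall_pos_le_add fun ε hε => ?_)
  · refine (stageValue_le_succ σ₃ h k).trans (turnValue_mono σ₃ h fun s => ?_)
    exact stageValue_le_limitValue σ₃ _ hβ k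
  · have hev : ∀ᶠ k in Filter.atTop, ∀ s : State V,
        limitValue σ₃ β (h.snoc s) < stageValue σ₃ β k (h.snoc s) + ε :=
      Filter.eventually_all.2 fun s =>
        ((tendsto_stageValue σ₃ (h.snoc s) hβ).add_const ε).eventually_const_lt
          (lt_add_of_pos_right _ hε)
    obtain ⟨k, hk⟩ := hev.exists
    refine (turnValue_le_add σ₃ h hβ fun s => (hk s).le).trans ?_
    gcongr
    exact stageValue_le_limitValue σ₃ h hβ (k + 1)

/-- Within `k` stages no payoff is discounted by more than `β ^ k`. -/
theorem pow_mul_stageValue_le (hβ : β ≤ 1) (k : ℕ) :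
    β ^ k * stageValue σ₃ 1 k h ≤ stageValue σ₃ β k h := by
  induction k generalizing n with
  | zero => simp [stageValue]
  | succ k ih =>
    refine (mul_gameValue_le (δ := 0) (legalMoves_nonempty _ _) (legalMoves_nonempty _ _)
      fun a₁ _ a₂ _ => ?_).trans_eq (add_zero _)
    rw [add_zero]
    unfold turnPayoff
    rw [mul_add, one_mul]
    refine add_le_add (mul_le_of_le_one_left' (pow_le_one₀ zero_le hβ)) ?_
    rw [pow_succ', mul_assoc, Finset.mul_sum]
    refine mul_le_mul_right (Finset.sum_le_sum fun s _ => ?_) _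
    rw [mul_left_comm]
    exact mul_le_mul_right (ih _) _

/-- Fix the horizon `k` before moving `β`: a finite-stage value nearly attains the undiscounted
limit, and for this fixed `k` the factor `β ^ k` tends to 1. Finiteness of the state set makes `β`
uniform. -/
theorem exists_limitValue_le_add {ε : ℝ≥0} (hε : 0 < ε) :
    ∃ β < 1, ∀ s : State V,
      limitValue σ₃ 1 (.start s) ≤ limitValue σ₃ β (.start s) + ε := by
  have key : ∀ s : State V, ∀ᶠ β in nhdsWithin (1 : ℝ≥0) (Set.Iio 1),
      limitValue σ₃ 1 (.start s) ≤ limitValue σ₃ β (.start s) + ε := fun s => by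
    obtain ⟨k, hk⟩ := (((tendsto_stageValue σ₃ (.start s) le_rfl).add_const
      ε).eventually_const_lt (lt_add_of_pos_right _ hε)).exists
    have hc : Continuous fun β : ℝ≥0 => β ^ k * stageValue σ₃ 1 k (.start s) + ε := by fun_prop
    have hev := (hc.tendsto 1).eventually_const_lt (by simpa using hk)
    filter_upwards [nhdsWithin_le_nhds hev, self_mem_nhdsWithin] with β hβ hβ₁
    refine hβ.le.trans ?_
    gcongr
    exact (pow_mul_stageValue_le σ₃ _ (le_of_lt hβ₁) k).trans
      (stageValue_le_limitValue σ₃ _ (le_of_lt hβ₁) k)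
  have : (nhdsWithin (1 : ℝ≥0) (Set.Iio 1)).NeBot := nhdsLT_neBot_of_exists_lt ⟨0, zero_lt_one⟩
  obtain ⟨β, hβ, hβ₁⟩ := ((Filter.eventually_all.2 key).and self_mem_nhdsWithin).exists
  exact ⟨β, hβ₁, hβ⟩

end

/-! ### The play measure and one-step inequalities -/

/-- The history up to time `n` of the play `ω`. -/
def History.ofPlay (n : ℕ) (ω : ℕ → State V) : History V n := Preorder.frestrictLe n ω

theorem History.measurable_ofPlay (n : ℕ) :
    Measurable (History.ofPlay n : (ℕ → State V) → History V n) :=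
  Preorder.measurable_frestrictLe n

section

variable [Fintype V] {G : SimpleGraph V}

theorem lintegral_pmf_toMeasure (μ : PMF (State V)) (f : State V → ℝ≥0∞) :
    ∫⁻ s, f s ∂μ.toMeasure = ∑ s, μ s * f s := by
  rw [lintegral_fintype]
  refine Finset.sum_congr rfl fun s _ => ?_
  rw [PMF.toMeasure_apply_singleton _ _ (measurableSet_singleton s), mul_comm]

theorem coe_turnPayoff (σ₃ : Strategy G .robber) (β : ℝ≥0) {n : ℕ} (h : History V n)
    (w : State V → ℝ≥0) (a₁ a₂ : Option V) :
    (turnPayoff σ₃ β h w a₁ a₂ : ℝ≥0∞) =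
      immediatePayoff h.last + β * ∑ s, transition σ₃ h a₁ a₂ s * w s := by
  unfold turnPayoff
  push_cast
  simp only [ENNReal.coe_toNNReal (PMF.apply_ne_top _ _)]

theorem tsum_pmf_bind_mul {α γ : Type*} (μ : PMF α) (k : α → PMF γ) (f : γ → ℝ≥0∞) :
    ∑' c, μ.bind k c * f c = ∑' a, μ a * ∑' c, k a c * f c := by
  simp only [PMF.bind_apply, ← ENNReal.tsum_mul_right, ← ENNReal.tsum_mul_left, mul_assoc]
  exact ENNReal.tsum_comm

/-- This identifies averaging the matrix payoffs over both cops' independent moves with integrating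
against the law of the next state; the immediate payoff comes out because the mixed moves have mass
one. -/
theorem tsum_mul_tsum_turnPayoff (σ₁ : Strategy G .cop1) (σ₂ : Strategy G .cop2)
    (σ₃ : Strategy G .robber) (β : ℝ≥0) {n : ℕ} (h : History V n) (w : State V → ℝ≥0) :
    ∑' a₁, σ₁.prob n h a₁ * ∑' a₂, σ₂.prob n h a₂ * turnPayoff σ₃ β h w a₁ a₂ =
      immediatePayoff h.last + β * ∫⁻ s, w s ∂(step σ₁ σ₂ σ₃ h).toMeasure := by
  rw [lintegral_pmf_toMeasure, ← tsum_fintype (L := .unconditional _), step]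
  simp only [tsum_pmf_bind_mul, coe_turnPayoff, mul_add, ENNReal.tsum_add, ENNReal.tsum_mul_right,
    PMF.tsum_coe, one_mul, ← tsum_fintype (L := .unconditional (State V)),
    mul_left_comm _ (β : ℝ≥0∞), ENNReal.tsum_mul_left]

variable (σ₁ : Strategy G .cop1) (σ₂ : Strategy G .cop2) (σ₃ : Strategy G .robber) (s₀ : State V)

instance : IsProbabilityMeasure (playMeasure σ₁ σ₂ σ₃ s₀) := by
  unfold playMeasure
  infer_instance

theorem lintegral_playMeasure_snoc (n : ℕ) (f : History V (n + 1) → ℝ≥0∞) :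
    ∫⁻ ω, f (History.ofPlay (n + 1) ω) ∂playMeasure σ₁ σ₂ σ₃ s₀ =
      ∫⁻ ω, ∫⁻ s, f ((History.ofPlay n ω).snoc s)
        ∂(step σ₁ σ₂ σ₃ (History.ofPlay n ω)).toMeasure ∂playMeasure σ₁ σ₂ σ₃ s₀ := by
  set κ := stepKernel σ₁ σ₂ σ₃
  have hm : ∀ {m : ℕ} (g : History V m → ℝ≥0∞), Measurable g := fun g => measurable_of_countable g
  have hF : Measurable fun p : History V n × State V => f (History.snoc p.1 p.2) :=
    measurable_of_countable _
  have hsnoc : ∀ ω : ℕ → State V,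
      (History.ofPlay n ω).snoc (ω (n + 1)) =
        History.ofPlay (n + 1) ω := fun ω => by
    funext i
    have hi := Finset.mem_Iic.1 i.2
    by_cases hin : i.1 ≤ n
    · simp [History.snoc, History.ofPlay, hin]
    · have : i.1 = n + 1 := by omega
      simp [History.snoc, History.ofPlay, this]
  -- Ionescu-Tulcea: the joint law of the history up to `n` and the next state is the composition
  -- product of the law of that history with the step kernel.
  have h₁ := congrArg (fun μ : Measure (History V n × State V) => ∫⁻ p, f (p.1.snoc p.2) ∂μ)
    (Kernel.partialTraj_compProd_eq_map_traj (X := fun _ => State V) (κ := κ)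
      (Nat.zero_le n) (x₀ := History.start s₀))
  rw [Measure.lintegral_compProd hF, lintegral_map hF (by fun_prop),
    ← Kernel.traj_map_frestrictLe_apply, lintegral_map (hm _) (by fun_prop)] at h₁
  simp only [← hsnoc]
  exact h₁.symm

theorem playMeasure_zero_ae : ∀ᵐ ω ∂playMeasure σ₁ σ₂ σ₃ s₀,
    (History.ofPlay 0 ω) = .start s₀ := by
  have h := Kernel.traj_map_frestrictLe_apply (X := fun _ => State V)
    (κ := stepKernel σ₁ σ₂ σ₃) 0 0 (History.start s₀)
  rw [Kernel.partialTraj_self, Kernel.id_apply] at h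
  have h' : ∀ᵐ x ∂(Measure.dirac (History.start s₀)), x = History.start s₀ := by
    rw [ae_dirac_iff (MeasurableSet.of_discrete)]
  erw [← h] at h'
  exact ae_of_ae_map (History.measurable_ofPlay 0).aemeasurable h'

theorem expectedPayoff_eq_tsum :
    expectedPayoff σ₁ σ₂ σ₃ s₀ =
      ∑' t, ∫⁻ ω, (immediatePayoff (ω t) : ℝ≥0∞) ∂playMeasure σ₁ σ₂ σ₃ s₀ :=
  lintegral_tsum fun t => by
    have : Measurable fun s : State V => (immediatePayoff s : ℝ≥0∞) := measurable_of_countable _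
    exact (this.comp (measurable_pi_apply t)).aemeasurable

variable {σ₁ σ₂ σ₃} {β : ℝ≥0} {w : ∀ n, History V n → ℝ≥0}

theorem lintegral_history_zero :
    ∫⁻ ω, w 0 (History.ofPlay 0 ω) ∂playMeasure σ₁ σ₂ σ₃ s₀ = w 0 (.start s₀) := by
  rw [lintegral_congr_ae (g := fun _ => (w 0 (.start s₀) : ℝ≥0∞))]
  · simp
  · filter_upwards [playMeasure_zero_ae σ₁ σ₂ σ₃ s₀] with ω hω
    rw [hω]

/-- The expected one-turn payoff plus continuation, conditioned on the past. It serves the upper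
bound with `β = 1` and the lower bound with `β < 1`. -/
theorem lintegral_payoff_add (n : ℕ) :
    ∫⁻ ω, (immediatePayoff (ω n) : ℝ≥0∞) ∂playMeasure σ₁ σ₂ σ₃ s₀ +
        β * ∫⁻ ω, w (n + 1) (History.ofPlay (n + 1) ω) ∂playMeasure σ₁ σ₂ σ₃ s₀ =
      ∫⁻ ω, (immediatePayoff (History.ofPlay n ω).last +
        β * ∫⁻ s, w (n + 1) ((History.ofPlay n ω).snoc s)
          ∂(step σ₁ σ₂ σ₃ (History.ofPlay n ω)).toMeasure)
        ∂playMeasure σ₁ σ₂ σ₃ s₀ := by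
  have hm : Measurable fun h : History V n => (immediatePayoff h.last : ℝ≥0∞) :=
    measurable_of_countable _
  have hm' : Measurable fun h : History V n =>
      ∫⁻ s, (w (n + 1) (h.snoc s) : ℝ≥0∞) ∂(step σ₁ σ₂ σ₃ h).toMeasure :=
    measurable_of_countable _
  have hmω : Measurable fun ω => ∫⁻ s, (w (n + 1) ((History.ofPlay n ω).snoc s) : ℝ≥0∞)
      ∂(step σ₁ σ₂ σ₃ (History.ofPlay n ω)).toMeasure :=
    hm'.comp (History.measurable_ofPlay n)
  rw [lintegral_playMeasure_snoc σ₁ σ₂ σ₃ s₀ n fun h => (w (n + 1) h : ℝ≥0∞),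
    lintegral_add_left (f := fun ω => (immediatePayoff (History.ofPlay n ω).last : ℝ≥0∞))
      (hm.comp (History.measurable_ofPlay n)), lintegral_const_mul _ hmω]
  rfl

/-- The inequalities `Q n + W (n + 1) ≤ W n` telescope, and the remainder `W n` is dropped because
it is nonnegative. No decay is required, so no discounting either. -/
theorem expectedPayoff_le
    (hw : ∀ n (h : History V n), immediatePayoff h.last +
      ∫⁻ s, w (n + 1) (h.snoc s) ∂(step σ₁ σ₂ σ₃ h).toMeasure ≤ w n h) :
    expectedPayoff σ₁ σ₂ σ₃ s₀ ≤ w 0 (.start s₀) := by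
  rw [expectedPayoff_eq_tsum, ← lintegral_history_zero (w := w) (σ₁ := σ₁) (σ₂ := σ₂) (σ₃ := σ₃)]
  set Q : ℕ → ℝ≥0∞ := fun t => ∫⁻ ω, (immediatePayoff (ω t) : ℝ≥0∞) ∂playMeasure σ₁ σ₂ σ₃ s₀
  set W : ℕ → ℝ≥0∞ := fun n => ∫⁻ ω, w n (History.ofPlay n ω) ∂playMeasure σ₁ σ₂ σ₃ s₀
  have hstep : ∀ n, Q n + W (n + 1) ≤ W n := fun n => by
    have := lintegral_payoff_add (σ₁ := σ₁) (σ₂ := σ₂) (σ₃ := σ₃) s₀ (β := 1) (w := w) n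
    rw [ENNReal.coe_one, one_mul] at this
    refine this.trans_le (lintegral_mono fun ω => ?_)
    rw [one_mul]
    exact hw n _
  have hsum : ∀ n, ∑ t ∈ Finset.range n, Q t + W n ≤ W 0 := fun n => by
    induction n with
    | zero => simp
    | succ n ih =>
      rw [Finset.sum_range_succ, add_assoc]
      exact (add_le_add_right (hstep n) _).trans ih
  exact ENNReal.tsum_le_of_sum_range_le fun n => le_self_add.trans (hsum n)

/-- Here the remainder cannot be dropped. Discounting and the bound `w ≤ 1` make it at most `β ^ n`,
which vanishes in the limit. -/
theorem le_expectedPayoff (hβ : β < 1) (hw₁ : ∀ n (h : History V n), w n h ≤ 1)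
    (hw : ∀ n (h : History V n), w n h ≤ immediatePayoff h.last +
      β * ∫⁻ s, w (n + 1) (h.snoc s) ∂(step σ₁ σ₂ σ₃ h).toMeasure) :
    w 0 (.start s₀) ≤ expectedPayoff σ₁ σ₂ σ₃ s₀ := by
  rw [expectedPayoff_eq_tsum, ← lintegral_history_zero (w := w) (σ₁ := σ₁) (σ₂ := σ₂) (σ₃ := σ₃)]
  set Q : ℕ → ℝ≥0∞ := fun t => ∫⁻ ω, (immediatePayoff (ω t) : ℝ≥0∞) ∂playMeasure σ₁ σ₂ σ₃ s₀
  set W : ℕ → ℝ≥0∞ := fun n => ∫⁻ ω, w n (History.ofPlay n ω) ∂playMeasure σ₁ σ₂ σ₃ s₀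
  have hβ' : (β : ℝ≥0∞) < 1 := by exact_mod_cast hβ
  have hstep : ∀ n, W n ≤ Q n + β * W (n + 1) := fun n => by
    have := lintegral_payoff_add (σ₁ := σ₁) (σ₂ := σ₂) (σ₃ := σ₃) s₀ (β := β) (w := w) n
    exact (lintegral_mono fun ω => hw n _).trans_eq this.symm
  have hW : ∀ n, W n ≤ 1 := fun n => by
    refine (lintegral_mono (g := fun _ => 1) fun ω => ?_).trans_eq (by simp)
    exact ENNReal.coe_le_one_iff.2 (hw₁ n _)
  have hsum : ∀ n, W 0 ≤ ∑ t ∈ Finset.range n, Q t + (β : ℝ≥0∞) ^ n * W n := fun n => by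
    induction n with
    | zero => simp
    | succ n ih =>
      refine ih.trans ?_
      rw [Finset.sum_range_succ, add_assoc]
      refine add_le_add_right ((mul_le_mul_right (hstep n) _).trans ?_) _
      rw [mul_add, ← mul_assoc, ← pow_succ]
      -- The discount on the payoff `Q n` is discarded, which only enlarges the right side; the one
      -- on the remainder is kept.
      exact add_le_add_left (mul_le_of_le_one_left' (pow_le_one₀ zero_le hβ'.le)) _
  have hlim : Filter.Tendsto (fun n => ∑' t, Q t + (β : ℝ≥0∞) ^ n) .atTop (nhds (∑' t, Q t + 0)) :=
    (ENNReal.tendsto_pow_atTop_nhds_zero_of_lt_one hβ').const_add _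
  rw [add_zero] at hlim
  refine ge_of_tendsto' hlim fun n => (hsum n).trans ?_
  exact add_le_add (ENNReal.sum_le_tsum _) (mul_le_of_le_one_right' (hW n))

end

/-! ### Greedy strategies and the value of the game -/

section

variable [Fintype V] {G : SimpleGraph V}

variable (G) in
/-- An optimal mixed move of the first cop in the one-turn game with payoff `Γ` in the state `s`. -/
noncomputable def maximinMove (s : State V) (Γ : Option V → Option V → ℝ≥0) : PMF (Option V) :=
  (exists_maximin_pmf (legalMoves_nonempty (G := G) .cop1 s)
    (legalMoves_nonempty (G := G) .cop2 s) Γ).choose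

variable (G) in
/-- An optimal mixed move of the second cop in the one-turn game with payoff `Γ` in the state
`s`. -/
noncomputable def minimaxMove (s : State V) (Γ : Option V → Option V → ℝ≥0) : PMF (Option V) :=
  (exists_minimax_pmf (legalMoves_nonempty (G := G) .cop1 s)
    (legalMoves_nonempty (G := G) .cop2 s) Γ).choose

theorem maximinMove_spec (s : State V) (Γ : Option V → Option V → ℝ≥0) :
    (∀ a ∉ legalMoves G .cop1 s, maximinMove G s Γ a = 0) ∧
      ∀ b ∈ legalMoves G .cop2 s,
        (gameValue (legalMoves G .cop1 s) (legalMoves G .cop2 s) Γ : ℝ≥0∞) ≤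
          ∑' a, maximinMove G s Γ a * Γ a b :=
  (exists_maximin_pmf (legalMoves_nonempty (G := G) .cop1 s)
    (legalMoves_nonempty (G := G) .cop2 s) Γ).choose_spec

theorem minimaxMove_spec (s : State V) (Γ : Option V → Option V → ℝ≥0) :
    (∀ b ∉ legalMoves G .cop2 s, minimaxMove G s Γ b = 0) ∧
      ∀ a ∈ legalMoves G .cop1 s,
        ∑' b, minimaxMove G s Γ b * Γ a b ≤
          (gameValue (legalMoves G .cop1 s) (legalMoves G .cop2 s) Γ : ℝ≥0∞) :=
  (exists_minimax_pmf (legalMoves_nonempty (G := G) .cop1 s)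
    (legalMoves_nonempty (G := G) .cop2 s) Γ).choose_spec

/-- After each history, the first cop plays optimally in the one-turn game in which the
continuation is worth `w` and is discounted by `β`. -/
noncomputable def greedy₁ (σ₃ : Strategy G .robber) (β : ℝ≥0) (w : ∀ n, History V n → ℝ≥0) :
    Strategy G .cop1 where
  prob n h := maximinMove G h.last (turnPayoff σ₃ β h fun s => w (n + 1) (h.snoc s))
  legal _ _ := (maximinMove_spec _ _).1

/-- After each history, the second cop plays optimally in the one-turn game in which the
continuation is worth `w` and is discounted by `β`. -/
noncomputable def greedy₂ (σ₃ : Strategy G .robber) (β : ℝ≥0) (w : ∀ n, History V n → ℝ≥0) :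
    Strategy G .cop2 where
  prob n h := minimaxMove G h.last (turnPayoff σ₃ β h fun s => w (n + 1) (h.snoc s))
  legal _ _ := (minimaxMove_spec _ _).1

variable {σ₃ : Strategy G .robber} {β : ℝ≥0} {w : ∀ n, History V n → ℝ≥0}

theorem turnValue_le_greedy₁ (σ₂ : Strategy G .cop2) {n : ℕ} (h : History V n) :
    (turnValue σ₃ β h fun s => w (n + 1) (h.snoc s)) ≤ immediatePayoff h.last +
      β * ∫⁻ s, w (n + 1) (h.snoc s) ∂(step (greedy₁ σ₃ β w) σ₂ σ₃ h).toMeasure := by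
  rw [← tsum_mul_tsum_turnPayoff (greedy₁ σ₃ β w) σ₂ σ₃ β h fun s => w (n + 1) (h.snoc s)]
  -- The sums are interchanged to put C₂'s move outermost, since the maximin guarantee holds for
  -- each fixed move of C₂.
  simp only [← ENNReal.tsum_mul_left]
  rw [ENNReal.tsum_comm]
  simp only [mul_left_comm ((greedy₁ σ₃ β w).prob n h _), ENNReal.tsum_mul_left]
  exact le_tsum_pmf_mul _ (σ₂.legal n h) (maximinMove_spec _ _).2

theorem greedy₂_le_turnValue (σ₁ : Strategy G .cop1) {n : ℕ} (h : History V n) :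
    immediatePayoff h.last +
      β * ∫⁻ s, w (n + 1) (h.snoc s) ∂(step σ₁ (greedy₂ σ₃ β w) σ₃ h).toMeasure ≤
      (turnValue σ₃ β h fun s => w (n + 1) (h.snoc s)) := by
  rw [← tsum_mul_tsum_turnPayoff σ₁ (greedy₂ σ₃ β w) σ₃ β h fun s => w (n + 1) (h.snoc s)]
  exact tsum_pmf_mul_le _ (σ₁.legal n h) (minimaxMove_spec _ _).2

theorem limitValue_le_expectedPayoff (hβ : β < 1) (σ₂ : Strategy G .cop2) (s₀ : State V) :
    limitValue σ₃ β (.start s₀) ≤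
      expectedPayoff (greedy₁ σ₃ β fun _ => limitValue σ₃ β) σ₂ σ₃ s₀ := by
  refine le_expectedPayoff (w := fun _ => limitValue σ₃ β) s₀ hβ
    (fun n h => limitValue_le_one σ₃ h hβ.le) fun n h => ?_
  rw [limitValue_eq_turnValue σ₃ h hβ.le]
  exact turnValue_le_greedy₁ (w := fun _ => limitValue σ₃ β) σ₂ h

theorem expectedPayoff_le_limitValue (σ₁ : Strategy G .cop1) (s₀ : State V) :
    expectedPayoff σ₁ (greedy₂ σ₃ 1 fun _ => limitValue σ₃ 1) σ₃ s₀ ≤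
      limitValue σ₃ 1 (.start s₀) := by
  refine expectedPayoff_le (w := fun _ => limitValue σ₃ 1) s₀ fun n h => ?_
  rw [limitValue_eq_turnValue σ₃ h le_rfl]
  simpa using greedy₂_le_turnValue (β := 1) (w := fun _ => limitValue σ₃ 1) σ₁ h

theorem isEpsOptimal₂_greedy₂ :
    IsEpsOptimal₂ σ₃ (fun s => limitValue σ₃ 1 (.start s)) 0
      (greedy₂ σ₃ 1 fun _ => limitValue σ₃ 1) := fun s₀ => by
  simpa using fun σ₁ => expectedPayoff_le_limitValue σ₁ s₀

theorem exists_isEpsOptimal₁_greedy₁ (σ₃ : Strategy G .robber) {ε : ℝ≥0} (hε : 0 < ε) :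
    ∃ β, IsEpsOptimal₁ σ₃ (fun s => limitValue σ₃ 1 (.start s)) ε
      (greedy₁ σ₃ β fun _ => limitValue σ₃ β) := by
  obtain ⟨β, hβ, h⟩ := exists_limitValue_le_add σ₃ hε
  refine ⟨β, fun s₀ => (ENNReal.coe_le_coe.2 (h s₀)).trans ?_⟩
  rw [ENNReal.coe_add]
  gcongr
  exact le_iInf fun σ₂ => limitValue_le_expectedPayoff hβ σ₂ s₀

/-- C₂'s greedy strategy bounds inf sup from above, C₁'s near-optimal ones bound sup inf from below,
and sup inf ≤ inf sup closes the chain. -/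
theorem isValue_limitValue (σ₃ : Strategy G .robber) (s₀ : State V) :
    IsValue σ₃ s₀ (limitValue σ₃ 1 (.start s₀)) := by
  have hle := iSup_iInf_le_iInf_iSup fun (σ₁ : Strategy G .cop1) (σ₂ : Strategy G .cop2) =>
    expectedPayoff σ₁ σ₂ σ₃ s₀
  have hupper := (iInf_le (fun σ₂ : Strategy G .cop2 => ⨆ σ₁ : Strategy G .cop1,
    expectedPayoff σ₁ σ₂ σ₃ s₀) _).trans (iSup_le fun σ₁ => expectedPayoff_le_limitValue σ₁ s₀)
  have hlower : (limitValue σ₃ 1 (.start s₀) : ℝ≥0∞) ≤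
      ⨆ σ₁ : Strategy G .cop1, ⨅ σ₂ : Strategy G .cop2, expectedPayoff σ₁ σ₂ σ₃ s₀ := by
    refine ENNReal.le_of_forall_pos_le_add fun ε hε _ => ?_
    obtain ⟨β, hβ⟩ := exists_isEpsOptimal₁_greedy₁ σ₃ hε
    refine (hβ s₀).trans ?_
    gcongr
    exact le_iSup (fun σ₁ : Strategy G .cop1 => ⨅ σ₂ : Strategy G .cop2,
      expectedPayoff σ₁ σ₂ σ₃ s₀) _
  exact ⟨(hle.trans hupper).antisymm hlower, hupper.antisymm (hlower.trans hle)⟩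

/-! ### Stationary Markovian robbers and the optimality equations -/

section Stationary

variable (hσ₃ : σ₃.IsStationaryMarkovian)

include hσ₃ in
theorem Strategy.IsStationaryMarkovian.transition_eq {n : ℕ} (h : History V n)
    (a₁ a₂ : Option V) :
    transition σ₃ h a₁ a₂ = transition σ₃ (.start h.last) a₁ a₂ := by
  obtain ⟨f, hf⟩ := hσ₃
  simp [transition, hf]

include hσ₃ in
theorem Strategy.IsStationaryMarkovian.turnPayoff_eq {n : ℕ} (h : History V n)
    (w : State V → ℝ≥0) :
    turnPayoff σ₃ β h w = turnPayoff σ₃ β (.start h.last) w := by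
  funext a₁ a₂
  simp only [turnPayoff, hσ₃.transition_eq h, History.last_start]

include hσ₃ in
theorem Strategy.IsStationaryMarkovian.stageValue_eq (k : ℕ) {n : ℕ} (h : History V n) :
    stageValue σ₃ β k h = stageValue σ₃ β k (.start h.last) := by
  induction k generalizing n with
  | zero => rfl
  | succ k ih =>
    have h₁ : (fun s => stageValue σ₃ β k (h.snoc s)) =
        fun s => stageValue σ₃ β k ((History.start h.last).snoc s) := by
      funext s
      rw [ih (h.snoc s), ih ((History.start h.last).snoc s), History.last_snoc, History.last_snoc]
    simp only [stageValue, turnValue]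
    rw [h₁, hσ₃.turnPayoff_eq h, History.last_start]

include hσ₃ in
theorem Strategy.IsStationaryMarkovian.limitValue_eq {n : ℕ} (h : History V n) :
    limitValue σ₃ β h = limitValue σ₃ β (.start h.last) := by
  simp only [limitValue, hσ₃.stageValue_eq _ h]

include hσ₃ in
theorem Strategy.IsStationaryMarkovian.limitValue_snoc {n : ℕ} (h : History V n) (s : State V) :
    limitValue σ₃ β (h.snoc s) = limitValue σ₃ β (.start s) := by
  rw [hσ₃.limitValue_eq, History.last_snoc]

include hσ₃ in
theorem Strategy.IsStationaryMarkovian.greedy₁ :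
    (greedy₁ σ₃ β fun _ => limitValue σ₃ β).IsStationaryMarkovian := by
  -- The move distribution of a state is read off at the one-state history; both the payoff matrix
  -- and the continuation values there agree with those after any history ending in that state.
  refine ⟨fun s => (SCPR.greedy₁ σ₃ β fun _ => limitValue σ₃ β).prob 0 (.start s), fun n h => ?_⟩
  simp only [SCPR.greedy₁, hσ₃.limitValue_snoc, hσ₃.turnPayoff_eq h, History.last_start]

include hσ₃ in
theorem Strategy.IsStationaryMarkovian.greedy₂ :
    (greedy₂ σ₃ β fun _ => limitValue σ₃ β).IsStationaryMarkovian := by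
  refine ⟨fun s => (SCPR.greedy₂ σ₃ β fun _ => limitValue σ₃ β).prob 0 (.start s), fun n h => ?_⟩
  simp only [SCPR.greedy₂, hσ₃.limitValue_snoc, hσ₃.turnPayoff_eq h, History.last_start]

theorem solvesOptimalityEquations_iff {v : State V → ℝ≥0} :
    SolvesOptimalityEquations σ₃ v ↔
      v .terminal = 0 ∧ ∀ x, v (.active x) = turnValue σ₃ 1 (.start (.active x)) v := by
  refine and_congr_right fun _ => forall_congr' fun x => ?_
  rw [← NNReal.coe_inj, turnValue, coe_gameValue (legalMoves_nonempty _ _)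
    (legalMoves_nonempty _ _)]
  simp only [turnPayoff, one_mul, NNReal.coe_add, NNReal.coe_sum, NNReal.coe_mul]
  rfl

-- Minimality comes from induction on the number of stages: the iteration starts at 0, below any
-- nonnegative solution, and the monotone one-turn operator, which fixes that solution at active
-- states, preserves the comparison.
include hσ₃ in
theorem Strategy.IsStationaryMarkovian.isLeast_limitValue :
    IsLeast {v : State V → ℝ≥0 | SolvesOptimalityEquations σ₃ v}
      fun s => limitValue σ₃ 1 (.start s) := by
  refine ⟨(solvesOptimalityEquations_iff (v := fun s => limitValue σ₃ 1 (.start s))).2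
    ⟨limitValue_of_last_eq_terminal σ₃ _ rfl, fun x => ?_⟩, fun v hv => ?_⟩
  · rw [limitValue_eq_turnValue σ₃ _ le_rfl]
    simp only [hσ₃.limitValue_snoc]
  · obtain ⟨-, hv⟩ := solvesOptimalityEquations_iff.1 hv
    have key : ∀ k s, stageValue σ₃ 1 k (.start s) ≤ v s := fun k => by
      induction k with
      | zero => exact fun s => zero_le
      | succ k ih =>
        intro s
        cases s with
        | terminal => exact (stageValue_of_last_eq_terminal σ₃ _ _ rfl).trans_le zero_le
        | active x =>
          rw [hv x]
          refine turnValue_mono σ₃ _ fun s => ?_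
          rw [hσ₃.stageValue_eq, History.last_snoc]
          exact ih s
    exact fun s => ciSup_le fun k => key k s

end Stationary

end

end SCPR

theorem mainTheorem1 {V : Type*} [Fintype V] (G : SimpleGraph V) (hG : G.Connected)
    (σ₃ : SCPR.Strategy G .robber) :
    ∃ v : SCPR.State V → ℝ≥0,
      (∀ s : SCPR.State V, SCPR.IsValue σ₃ s (v s)) ∧
      (σ₃.IsStationaryMarkovian →
        IsLeast {w : SCPR.State V → ℝ≥0 | SCPR.SolvesOptimalityEquations σ₃ w} v ∧
        (∃ σ₂ : SCPR.Strategy G .cop2,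
          σ₂.IsStationaryMarkovian ∧ SCPR.IsEpsOptimal₂ σ₃ v 0 σ₂) ∧
        ∀ ε : ℝ≥0, 0 < ε → ∃ σ₁ : SCPR.Strategy G .cop1,
          σ₁.IsStationaryMarkovian ∧ SCPR.IsEpsOptimal₁ σ₃ v ε σ₁) := by
  refine ⟨fun s => SCPR.limitValue σ₃ 1 (.start s), SCPR.isValue_limitValue σ₃, fun hσ₃ =>
    ⟨hσ₃.isLeast_limitValue, ⟨_, hσ₃.greedy₂, SCPR.isEpsOptimal₂_greedy₂⟩, fun ε hε => ?_⟩⟩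
  obtain ⟨β, hβ⟩ := SCPR.exists_isEpsOptimal₁_greedy₁ σ₃ hε
  exact ⟨_, hσ₃.greedy₁, hβ⟩
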